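/- Let $Y=[0,2\pi)^d$ and let $A=(a_{jk})_{j,k=1}^d$ be a matrix of real, bounded, measurable functions on $\mathbb{R}^d$ which is symmetric, $Y$-periodic ($A(y+2\pi p)=A(y)$ for all $p\in\mathbb{Z}^d$ and a.e. $y$), and elliptic: there is $\alpha>0$ with $A(y)\xi\cdot\xi\ge\alpha|\xi|^2$ for all $\xi\in\mathbb{R}^d$ and a.e. $y$. Let $H^2_\sharp(Y)$ be the space of $Y$-periodic functions $u\in L^2(Y)$ with $\sum_{n\in\mathbb{Z}^d}(1+|n|^2)^2|\hat u(n)|^2<\infty$. For $\rho>0$ and $\eta\in\mathbb{R}^d$, a real number $\lambda$ is a Bloch eigenvalue if there is a nonzero $\phi\in H^2_\sharp(Y)$ solving $$\rho^2(\nabla+i\eta)^4\phi-(\nabla+i\eta)\cdot A(y)(\nabla+i\eta)\phi=\lambda\phi$$ in the weak sense, that is, for all $v\in H^2_\sharp(Y)$, $$\int_Y A(\nabla+i\eta)\phi\cdot\overline{(\nabla+i\eta)v}\,dy+\rho^2\int_Y(\nabla+i\eta)^2\phi\,\overline{(\nabla+i\eta)^2v}\,dy=\lambda\int_Y\phi\,\overline{v}\,dy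 .$$ **Theorem 4.4.** There is $\delta>0$, independent of $\rho$, such that for every $\rho>0$ the following holds: for each $\eta$ in the ball $B_\delta(0)=\{\eta\in\mathbb{R}^d:|\eta|<\delta\}$ there is a smallest Bloch eigenvalue $\lambda_1^\rho(\eta)$ (the first Bloch eigenvalue), and the function $\eta\mapsto\lambda_1^\rho(\eta)$ is (real-)analytic on $B_\delta(0)$. -/

import Mathlib

namespace BlochWave

open MeasureTheory

/-- The normalized Haar measure of the torus `𝕋^d = ℝ^d / (2πℤ)^d`. A point of the torus is
recorded by the class `x` of `y / 2π` modulo `ℤ^d`, so that `dy = (2π)^d dx` on the cell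
`Y = [0, 2π)^d`. -/
noncomputable abbrev torusMeasure (d : ℕ) : Measure (UnitAddTorus (Fin d)) :=
  Measure.pi fun _ : Fin d => (AddCircle.haarAddCircle : Measure UnitAddCircle)

/-- The space `L²_♯(Y) = L²(𝕋^d)` of complex-valued `Y`-periodic functions that are square
integrable on `Y`. -/
abbrev L2Per (d : ℕ) : Type := Lp ℂ 2 (torusMeasure d)

/-- The Hilbert basis of `L²_♯(Y)` (for the normalized measure) given by the exponentials
`y ↦ exp (i n · y)`, `n ∈ ℤ^d`. -/
noncomputable def expBasis (d : ℕ) : HilbertBasis (Fin d → ℤ) ℂ (L2Per d) :=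
  UnitAddTorus.mFourierBasis (d := Fin d)

/-- The Fourier coefficient `û(n) = |Y|⁻¹ ∫_Y u(y) exp (-i n · y) dy`. -/
noncomputable def coeff {d : ℕ} (u : L2Per d) (n : Fin d → ℤ) : ℂ :=
  (expBasis d).repr u n

/-- Membership in `H²_♯(Y)`: `∑_n (1 + |n|²)² |û(n)|² < ∞`. -/
def MemH2Per {d : ℕ} (u : L2Per d) : Prop :=
  Summable fun n : Fin d → ℤ => (1 + ∑ j, (n j : ℝ) ^ 2) ^ 2 * ‖coeff u n‖ ^ 2

open Classical in
/-- The distributional derivative `∂u/∂y_j` of a periodic function, i.e. the function with Fourier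
coefficients `i n_j û(n)`, whenever this is an `L²` function. (It is only meant to be used in this
case, which holds for all `u ∈ H¹_♯(Y)`; the value `0` is a convention otherwise.) -/
noncomputable def pderiv {d : ℕ} (j : Fin d) (u : L2Per d) : L2Per d :=
  if h : Memℓp (fun n : Fin d → ℤ => Complex.I * (n j : ℂ) * coeff u n) 2 then
    (expBasis d).repr.symm ⟨_, h⟩
  else 0

/-- The `j`-th component `∂_j u + i η_j u` of the shifted gradient `(∇ + iη) u`. -/
noncomputable def shiftD {d : ℕ} (η : EuclideanSpace ℝ (Fin d)) (j : Fin d) (u : L2Per d) :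
    L2Per d :=
  pderiv j u + (Complex.I * (η j : ℂ)) • u

/-- The shifted Laplacian `(∇ + iη)² u = (∇ + iη) · (∇ + iη) u`. -/
noncomputable def shiftLap {d : ℕ} (η : EuclideanSpace ℝ (Fin d)) (u : L2Per d) : L2Per d :=
  ∑ j, shiftD η j (shiftD η j u)

/-- The representative in the cell `Y = [0, 2π)^d` of a point of the torus. -/
noncomputable def cellPoint {d : ℕ} (x : UnitAddTorus (Fin d)) : Fin d → ℝ :=
  fun j => 2 * Real.pi * (AddCircle.equivIco (1 : ℝ) 0 (x j) : ℝ)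

/-- The integral `∫_Y f(y) dy` over the cell `Y = [0, 2π)^d` of a periodic function, given as a
function on the torus. -/
noncomputable def cellIntegral {d : ℕ} (f : UnitAddTorus (Fin d) → ℂ) : ℂ :=
  ((2 * Real.pi) ^ d : ℝ) * ∫ x, f x ∂torusMeasure d

/-- The inner product `∫_Y u v̄ dy` of `L²_♯(Y)`. -/
noncomputable def innerY {d : ℕ} (u v : L2Per d) : ℂ :=
  cellIntegral fun x => u x * (starRingEnd ℂ) (v x)

/-- The sesquilinear form, on `H²_♯(Y) × H²_♯(Y)`,
`a^ρ[η](u,v) = ∫_Y A (∇+iη)u · conj((∇+iη)v) dy + ρ² ∫_Y (∇+iη)²u conj((∇+iη)²v) dy`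
associated with the shifted operator `ρ² (∇+iη)⁴ - (∇+iη) · A(y) (∇+iη)`. -/
noncomputable def blochForm {d : ℕ} (A : (Fin d → ℝ) → Matrix (Fin d) (Fin d) ℝ) (ρ : ℝ)
    (η : EuclideanSpace ℝ (Fin d)) (u v : L2Per d) : ℂ :=
  cellIntegral (fun x => ∑ j, ∑ k, (A (cellPoint x) j k : ℂ) * shiftD η k u x *
      (starRingEnd ℂ) (shiftD η j v x)) +
    (ρ : ℂ) ^ 2 * cellIntegral (fun x => shiftLap η u x * (starRingEnd ℂ) (shiftLap η v x))

/-- The set of eigenvalues of the Bloch eigenvalue problem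
`ρ² (∇+iη)⁴ φ - (∇+iη) · A(y) (∇+iη) φ = l φ`, `φ` periodic, in its weak form:
there is a nonzero `φ ∈ H²_♯(Y)` with `a^ρ[η](φ,v) = l ∫_Y φ v̄ dy` for all `v ∈ H²_♯(Y)`.
(The form is Hermitian, so that all eigenvalues are real.) -/
def blochEigenvalues {d : ℕ} (A : (Fin d → ℝ) → Matrix (Fin d) (Fin d) ℝ) (ρ : ℝ)
    (η : EuclideanSpace ℝ (Fin d)) : Set ℝ :=
  {l | ∃ φ : L2Per d, MemH2Per φ ∧ φ ≠ 0 ∧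
    ∀ v : L2Per d, MemH2Per v → blochForm A ρ η φ v = (l : ℂ) * innerY φ v}

/-- The first Bloch eigenvalue `λ₁^ρ(η)`, the smallest eigenvalue. -/
noncomputable def firstBlochEigenvalue {d : ℕ} (A : (Fin d → ℝ) → Matrix (Fin d) (Fin d) ℝ)
    (ρ : ℝ) (η : EuclideanSpace ℝ (Fin d)) : ℝ :=
  sInf (blochEigenvalues A ρ η)

end BlochWave

/-! Writing `φ = J f` with `J = (1 - Δ)⁻¹` turns the weak problem on `H²` into `T(η) f = l J² f` on
`L²`, where `T(η)` is bounded, self-adjoint and polynomial in `η`. Let `e` be the constant function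
and `μ = α/4 + ρ²/16`. For small `η` the form of `T(η)` dominates `μ J²` on the nonzero frequencies,
while its value at `e` is below `μ`. Hence `P(l) = T - l J² + μ ⟨e, ·⟩ e` is coercive for `l < μ`,
and such an `l` is an eigenvalue exactly when `μ G(l) = 1`, with `G(l) = ⟨e, P(l)⁻¹ e⟩`
(`HasGap.mem_pencilEigenvalues_iff`). Since `G' > 0` and `μ G - 1` changes sign between `0` and `⟨T
e, e⟩`, exactly one eigenvalue lies below `μ`; the analytic implicit function theorem makes it
analytic in `η` (`HasGap.analyticOnNhd_sInf`). The gap itself comes from `coercive_blochOp` and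
`re_inner_blochOp_constOne_lt`. -/

namespace BlochWave

open scoped ContDiff Topology InnerProductSpace

/-! ### Abstract pencils with one simple eigenvalue below a gap. -/

section Pencil

variable {E : Type*} [NormedAddCommGroup E] [InnerProductSpace ℂ E]

/-- The rank-one perturbation `T - l J² + μ ⟨e, ·⟩ e` of the pencil `T - l J²`. -/
noncomputable def pencil (T J : E →L[ℂ] E) (e : E) (μ l : ℝ) : E →L[ℂ] E :=
  T - (l : ℂ) • (J * J) + (μ : ℂ) • InnerProductSpace.rankOne ℂ e e

/-- The diagonal matrix element at `e` of the inverse of the perturbed pencil. -/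
noncomputable def green (T J : E →L[ℂ] E) (e : E) (μ l : ℝ) : ℝ :=
  (⟪e, Ring.inverse (pencil T J e μ l) e⟫_ℂ).re

/-- The real eigenvalues of the generalized eigenvalue problem `T f = l J² f`. -/
def pencilEigenvalues (T J : E →L[ℂ] E) : Set ℝ :=
  {l | ∃ f : E, f ≠ 0 ∧ T f = (l : ℂ) • J (J f)}

/-- The hypotheses under which the part of the spectrum of `T f = l J² f` below `μ` is a single
simple eigenvalue: coercivity holds after the direction `e` has been shifted by `μ`. -/
structure HasGap (T J : E →L[ℂ] E) (e : E) (μ : ℝ) : Prop where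
  symm_left : ∀ x y, ⟪T x, y⟫_ℂ = ⟪x, T y⟫_ℂ
  symm_right : ∀ x y, ⟪J x, y⟫_ℂ = ⟪x, J y⟫_ℂ
  injective : ∀ x, J x = 0 → x = 0
  map_base : J e = e
  norm_base : ‖e‖ = 1
  nonneg : ∀ f, 0 ≤ (⟪T f, f⟫_ℂ).re
  coercive : ∀ l < μ, ∃ c > 0, ∀ f,
    c * ‖f‖ ^ 2 ≤ (⟪T f, f⟫_ℂ).re - l * ‖J f‖ ^ 2 + μ * ‖⟪e, f⟫_ℂ‖ ^ 2
  lt : (⟪T e, e⟫_ℂ).re < μ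

lemma pencil_apply (T J : E →L[ℂ] E) (e : E) (μ l : ℝ) (f : E) :
    pencil T J e μ l f = T f - (l : ℂ) • J (J f) + (μ : ℂ) • ⟪e, f⟫_ℂ • e := by
  simp [pencil]

namespace HasGap

variable {T J : E →L[ℂ] E} {e : E} {μ l : ℝ}

lemma pos (h : HasGap T J e μ) : 0 < μ := (h.nonneg e).trans_lt h.lt

lemma inner_base (h : HasGap T J e μ) : ⟪e, e⟫_ℂ = 1 := by
  rw [inner_self_eq_norm_sq_to_K, h.norm_base]; simp

lemma pencil_symm (h : HasGap T J e μ) (x y : E) :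
    ⟪pencil T J e μ l x, y⟫_ℂ = ⟪x, pencil T J e μ l y⟫_ℂ := by
  simp only [pencil_apply, inner_add_left, inner_sub_left, inner_smul_left, inner_add_right,
    inner_sub_right, inner_smul_right, Complex.conj_ofReal, h.symm_left, h.symm_right,
    inner_conj_symm]
  ring

lemma re_inner_pencil (h : HasGap T J e μ) (f : E) :
    (⟪pencil T J e μ l f, f⟫_ℂ).re
      = (⟪T f, f⟫_ℂ).re - l * ‖J f‖ ^ 2 + μ * ‖⟪e, f⟫_ℂ‖ ^ 2 := by
  have h1 : ⟪J (J f), f⟫_ℂ = ((‖J f‖ ^ 2 : ℝ) : ℂ) := by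
    rw [h.symm_right, inner_self_eq_norm_sq_to_K]; simp
  have h2 : (starRingEnd ℂ) ⟪e, f⟫_ℂ * ⟪e, f⟫_ℂ = ((‖⟪e, f⟫_ℂ‖ ^ 2 : ℝ) : ℂ) := by
    rw [mul_comm, Complex.mul_conj, Complex.normSq_eq_norm_sq]
  simp only [pencil_apply, inner_add_left, inner_sub_left, inner_smul_left, Complex.conj_ofReal,
    h1, h2, Complex.add_re, Complex.sub_re, ← Complex.ofReal_mul, Complex.ofReal_re]

variable [CompleteSpace E]

lemma isUnit_pencil (h : HasGap T J e μ) (hl : l < μ) : IsUnit (pencil T J e μ l) := by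
  obtain ⟨c, hc, hcf⟩ := h.coercive l hl
  refine ContinuousLinearMap.isUnit_of_forall_le_norm_inner_map _ (c := ⟨c, hc.le⟩) hc fun f => ?_
  refine le_trans ?_ (Complex.re_le_norm _)
  rw [h.re_inner_pencil, mul_comm]
  exact hcf f

lemma pencil_inverse_apply (h : HasGap T J e μ) (hl : l < μ) (x : E) :
    pencil T J e μ l (Ring.inverse (pencil T J e μ l) x) = x := by
  rw [← mul_apply_eq_comp, Ring.mul_inverse_cancel _ (h.isUnit_pencil hl)]; rfl

lemma inverse_pencil_apply (h : HasGap T J e μ) (hl : l < μ) (x : E) :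
    Ring.inverse (pencil T J e μ l) (pencil T J e μ l x) = x := by
  rw [← mul_apply_eq_comp, Ring.inverse_mul_cancel _ (h.isUnit_pencil hl)]; rfl

lemma inverse_pencil_symm (h : HasGap T J e μ) (hl : l < μ) (x y : E) :
    ⟪Ring.inverse (pencil T J e μ l) x, y⟫_ℂ = ⟪x, Ring.inverse (pencil T J e μ l) y⟫_ℂ := by
  conv_lhs => rw [← h.pencil_inverse_apply hl y]
  rw [← h.pencil_symm, h.pencil_inverse_apply hl]

lemma ofReal_green (h : HasGap T J e μ) (hl : l < μ) :
    (green T J e μ l : ℂ) = ⟪e, Ring.inverse (pencil T J e μ l) e⟫_ℂ := by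
  refine Complex.conj_eq_iff_re.mp ?_
  rw [inner_conj_symm, h.inverse_pencil_symm hl]

/-- On an eigenvector `f` only the rank-one term of the pencil survives, so `f` is a multiple of
`P⁻¹ e`; pairing with `e` leaves a scalar equation. Conversely `P⁻¹ e` is an eigenvector. -/
lemma mem_pencilEigenvalues_iff (h : HasGap T J e μ) (hl : l < μ) :
    l ∈ pencilEigenvalues T J ↔ μ * green T J e μ l = 1 := by
  constructor
  · rintro ⟨f, hf, hfe⟩
    have h1 : pencil T J e μ l f = ((μ : ℂ) * ⟪e, f⟫_ℂ) • e := by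
      rw [pencil_apply, hfe, sub_self, zero_add, smul_smul]
    have h2 : f = ((μ : ℂ) * ⟪e, f⟫_ℂ) • Ring.inverse (pencil T J e μ l) e := by
      rw [← map_smul, ← h1, h.inverse_pencil_apply hl]
    have h3 : ⟪e, f⟫_ℂ ≠ 0 := by
      intro h0
      rw [h0, mul_zero, zero_smul] at h2
      exact hf h2
    have h4 : ⟪e, f⟫_ℂ = ((μ : ℂ) * ⟪e, f⟫_ℂ) * green T J e μ l := by
      rw [h.ofReal_green hl, ← inner_smul_right, ← h2]
    have h5 : ((μ * green T J e μ l : ℝ) : ℂ) = 1 := by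
      apply mul_left_cancel₀ h3
      push_cast
      linear_combination -h4
    exact_mod_cast h5
  · intro hg
    refine ⟨Ring.inverse (pencil T J e μ l) e, fun h0 => ?_, ?_⟩
    · rw [green, h0] at hg
      simp at hg
    · have h1 := h.pencil_inverse_apply hl e
      rw [pencil_apply, ← h.ofReal_green hl, smul_smul, ← Complex.ofReal_mul, hg] at h1
      simpa [sub_eq_zero] using h1

/-- With `f = P⁻¹ e` and `G = ⟨e, f⟩`, one has `G = ⟨P f, f⟩ = ⟨T f, f⟩ + μ G² ≥ μ G²`. -/
lemma green_zero_le (h : HasGap T J e μ) : μ * green T J e μ 0 ≤ 1 := by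
  have hμ := h.pos
  set f := Ring.inverse (pencil T J e μ 0) e with hf
  have h1 := h.re_inner_pencil (l := 0) f
  have h2 : ⟪e, f⟫_ℂ = green T J e μ 0 := (h.ofReal_green hμ).symm
  rw [hf, h.pencil_inverse_apply hμ, ← hf, h2] at h1
  have h3 := h.nonneg f
  simp only [Complex.ofReal_re, Complex.norm_real, Real.norm_eq_abs, sq_abs] at h1
  nlinarith [sq_nonneg (μ * green T J e μ 0 - 1)]

lemma le_green (h : HasGap T J e μ) : 1 ≤ μ * green T J e μ (⟪T e, e⟫_ℂ).re := by
  have hμ := h.pos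
  set l := (⟪T e, e⟫_ℂ).re with hl
  set f := Ring.inverse (pencil T J e μ l) e with hf
  have h2 : ⟪e, f⟫_ℂ = green T J e μ l := (h.ofReal_green h.lt).symm
  have h2' : ⟪f, e⟫_ℂ = green T J e μ l := by rw [← inner_conj_symm, h2, Complex.conj_ofReal]
  have hee := h.re_inner_pencil (l := l) e
  rw [h.map_base, h.norm_base, h.inner_base, ← hl] at hee
  obtain ⟨c, hc, hcf⟩ := h.coercive l h.lt
  -- At this `l` one has `⟨P e, e⟩ = μ`, so `0 ≤ ⟨P g, g⟩ = μ² G - 2μ + μ`. This is Cauchy–Schwarz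
  -- for the form of `P`.
  set g := (μ : ℂ) • f - e with hg
  have h3 : 0 ≤ (⟪pencil T J e μ l g, g⟫_ℂ).re := by
    rw [h.re_inner_pencil]
    exact le_trans (by positivity) (hcf g)
  have h4 : ⟪pencil T J e μ l e, f⟫_ℂ = 1 := by
    rw [h.pencil_symm, h.pencil_inverse_apply h.lt, h.inner_base]
  have h5 : ⟪pencil T J e μ l g, g⟫_ℂ
      = (μ : ℂ) * (μ * green T J e μ l) - μ - μ + ⟪pencil T J e μ l e, e⟫_ℂ := by
    rw [hg, map_sub, map_smul, hf, h.pencil_inverse_apply h.lt, ← hf]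
    simp only [inner_sub_left, inner_sub_right, inner_smul_left, inner_smul_right,
      Complex.conj_ofReal, h4, h2, h.inner_base]
    ring
  rw [h5] at h3
  simp only [Complex.add_re, Complex.sub_re, hee, ← Complex.ofReal_mul, Complex.ofReal_re,
    norm_one] at h3
  nlinarith

/-- The derivative of `P⁻¹` in `l` is `P⁻¹ J² P⁻¹`, and symmetry moves one factor `J P⁻¹` to the
other side. -/
lemma hasDerivAt_green (h : HasGap T J e μ) (hl : l < μ) :
    HasDerivAt (green T J e μ) (‖J (Ring.inverse (pencil T J e μ l) e)‖ ^ 2) l := by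
  obtain ⟨u, hu⟩ := h.isUnit_pencil hl
  have h1 : HasDerivAt (pencil T J e μ) (-(J * J)) l := by
    have h0 : HasDerivAt (fun l : ℝ => (l : ℂ) • (J * J)) (J * J) l := by
      simpa using (Complex.ofRealCLM.hasDerivAt (x := l)).smul_const (J * J)
    exact (h0.const_sub T).add_const ((μ : ℂ) • InnerProductSpace.rankOne ℂ e e)
  have h2 := hasFDerivAt_ringInverse (𝕜 := ℝ) u
  rw [hu] at h2
  have h3 := h2.comp_hasDerivAt l h1
  set ψ : (E →L[ℂ] E) →L[ℝ] ℝ := Complex.reCLM ∘L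
    ((innerSL ℂ e ∘L ContinuousLinearMap.apply ℂ E e).restrictScalars ℝ) with hψ
  have h4 := ψ.hasFDerivAt.comp_hasDerivAt l h3
  have hi : (↑u⁻¹ : E →L[ℂ] E) = Ring.inverse (pencil T J e μ l) := by
    rw [← hu, Ring.inverse_unit]
  convert! h4 using 1
  simp only [hψ, hi, neg_apply]
  simp only [ContinuousLinearMap.mulLeftRight_apply, mul_neg, neg_mul, neg_neg,
    ContinuousLinearMap.comp_apply, ContinuousLinearMap.coe_restrictScalars',
    ContinuousLinearMap.apply_apply, mul_apply_eq_comp, innerSL_apply_apply,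
    Complex.reCLM_apply]
  rw [← h.inverse_pencil_symm hl, ← h.symm_right, inner_self_eq_norm_sq_to_K]
  simp [← Complex.ofReal_pow]

lemma deriv_green_pos (h : HasGap T J e μ) (hl : l < μ) :
    0 < ‖J (Ring.inverse (pencil T J e μ l) e)‖ ^ 2 := by
  have : J (Ring.inverse (pencil T J e μ l) e) ≠ 0 := fun h0 => by
    have h1 := h.pencil_inverse_apply hl e
    rw [h.injective _ h0, map_zero] at h1
    simpa [← h1] using h.norm_base
  positivity

lemma strictMonoOn_green (h : HasGap T J e μ) : StrictMonoOn (green T J e μ) (Set.Iio μ) := by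
  refine strictMonoOn_of_deriv_pos (convex_Iio μ)
    (fun l hl => (h.hasDerivAt_green hl).continuousAt.continuousWithinAt) fun l hl => ?_
  rw [interior_Iio] at hl
  rw [(h.hasDerivAt_green hl).deriv]
  exact h.deriv_green_pos hl

lemma exists_eigenvalue (h : HasGap T J e μ) : ∃ l < μ, l ∈ pencilEigenvalues T J := by
  have hI : ContinuousOn (fun l => μ * green T J e μ l) (Set.Icc 0 (⟪T e, e⟫_ℂ).re) :=
    fun l hl => ((h.hasDerivAt_green (hl.2.trans_lt h.lt)).continuousAt.const_mul
      μ).continuousWithinAt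
  obtain ⟨l, hl, hl'⟩ := intermediate_value_Icc (h.nonneg e) hI ⟨h.green_zero_le, h.le_green⟩
  exact ⟨l, hl.2.trans_lt h.lt, (h.mem_pencilEigenvalues_iff (hl.2.trans_lt h.lt)).2 hl'⟩

lemma eigenvalue_unique (h : HasGap T J e μ) {l' : ℝ} (hl : l < μ) (hl' : l' < μ)
    (hm : l ∈ pencilEigenvalues T J) (hm' : l' ∈ pencilEigenvalues T J) : l = l' := by
  rw [h.mem_pencilEigenvalues_iff hl] at hm
  rw [h.mem_pencilEigenvalues_iff hl'] at hm'
  exact h.strictMonoOn_green.injOn hl hl' (mul_left_cancel₀ h.pos.ne' (hm.trans hm'.symm))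

lemma isLeast_of_mem (h : HasGap T J e μ) (hl : l < μ) (hm : l ∈ pencilEigenvalues T J) :
    IsLeast (pencilEigenvalues T J) l :=
  ⟨hm, fun l' hm' => (lt_or_ge l' μ).elim
    (fun hl' => (h.eigenvalue_unique hl hl' hm hm').le) fun hl' => hl.le.trans hl'⟩

lemma isLeast_sInf (h : HasGap T J e μ) :
    IsLeast (pencilEigenvalues T J) (sInf (pencilEigenvalues T J)) := by
  obtain ⟨l, hl, hm⟩ := h.exists_eigenvalue
  have := h.isLeast_of_mem hl hm
  rwa [this.csInf_eq]

variable {X : Type*} [NormedAddCommGroup X] [NormedSpace ℝ X]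

lemma contDiffAt_green {T : X → E →L[ℂ] E} (hT : ContDiff ℝ ω T) {x : X} (h : HasGap (T x) J e μ)
    (hl : l < μ) : ContDiffAt ℝ ω (fun p : X × ℝ => green (T p.1) J e μ p.2) (x, l) := by
  obtain ⟨u, hu⟩ := h.isUnit_pencil hl
  have h1 : ContDiff ℝ ω fun p : X × ℝ => pencil (T p.1) J e μ p.2 := by
    have h0 : ContDiff ℝ ω fun p : X × ℝ => (p.2 : ℂ) • (J * J) :=
      (Complex.ofRealCLM.contDiff.comp contDiff_snd).smul contDiff_const
    exact ((hT.comp contDiff_fst).sub h0).add contDiff_const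
  have h2 : ContDiffAt ℝ ω Ring.inverse (pencil (T x) J e μ l) := by
    rw [← hu]
    exact contDiffAt_ringInverse ℝ u
  have h3 := h2.comp (x, l) h1.contDiffAt
  exact (Complex.reCLM ∘L ((innerSL ℂ e ∘L
    ContinuousLinearMap.apply ℂ E e).restrictScalars ℝ)).contDiff.contDiffAt.comp (x, l) h3

/-- The first eigenvalue of an analytic family of pencils with a gap is analytic. -/
theorem analyticOnNhd_sInf [CompleteSpace X] {T : X → E →L[ℂ] E} (hT : ContDiff ℝ ω T) {U : Set X}
    (hU : IsOpen U) (h : ∀ x ∈ U, HasGap (T x) J e μ) :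
    AnalyticOnNhd ℝ (fun x => sInf (pencilEigenvalues (T x) J)) U := by
  intro x hx
  obtain ⟨l, hl, hm⟩ := (h x hx).exists_eigenvalue
  set F : X × ℝ → ℝ := fun p => green (T p.1) J e μ p.2 with hF
  have cF : ContDiffAt ℝ ω F (x, l) := contDiffAt_green hT (h x hx) hl
  have hd : fderiv ℝ F (x, l) (0, 1) = ‖J (Ring.inverse (pencil (T x) J e μ l) e)‖ ^ 2 := by
    have h1 := (cF.differentiableAt (by simp)).hasFDerivAt
    have h2 : HasDerivAt (fun s : ℝ => (x, s)) ((0 : X), (1 : ℝ)) l :=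
      (hasDerivAt_const l x).prodMk (hasDerivAt_id l)
    exact (h1.comp_hasDerivAt l h2).unique ((h x hx).hasDerivAt_green hl)
  have hinv : (fderiv ℝ F (x, l) ∘L .inr ℝ X ℝ).IsInvertible := by
    refine ⟨ContinuousLinearEquiv.unitsEquivAut ℝ (Units.mk0 _ ((h x hx).deriv_green_pos hl).ne'),
      ?_⟩
    ext
    simp [← hd]
  have hψ := cF.contDiffAt_implicitFunction (by simp) hinv
  have hself := cF.implicitFunction_apply_self (by simp) hinv
  have hev := cF.eventually_apply_implicitFunction (by simp) hinv
  set ψ := cF.implicitFunction (by simp) hinv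
  refine hψ.analyticAt.congr ?_
  have hlt : ∀ᶠ y in 𝓝 x, ψ y < μ :=
    hψ.continuousAt.eventually_lt continuousAt_const (by simpa [hself] using hl)
  -- The implicit function keeps `G` constant and stays below `μ`, so its value is the unique
  -- eigenvalue there, hence the least one.
  filter_upwards [hev, hlt, hU.mem_nhds hx] with y hy hyμ hyU
  refine (((h y hyU).isLeast_of_mem hyμ ?_).csInf_eq).symm
  rw [(h y hyU).mem_pencilEigenvalues_iff hyμ]
  have : green (T y) J e μ (ψ y) = green (T x) J e μ l := hy
  rw [this, ← (h x hx).mem_pencilEigenvalues_iff hl]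
  exact hm

end HasGap

/-! ### Analytic dependence on the shift `η`. -/

section ShiftedForm

variable {ι : Type*} [Fintype ι] (G H : ι → E →L[ℂ] E) (J : E →L[ℂ] E)

/-- The shift `G j + i η_j J` of the family of operators `G` by `η`. -/
noncomputable def shiftedGrad (η : EuclideanSpace ℝ ι) (j : ι) : E →L[ℂ] E :=
  G j + (Complex.I * (η j : ℂ)) • J

/-- The shift by `η` of the operator `∑ j, H j`, where `H j` stands for the square of `G j`. -/
noncomputable def shiftedLap (η : EuclideanSpace ℝ ι) : E →L[ℂ] E :=
  ∑ j, ((H j + (Complex.I * (η j : ℂ)) • G j) + (Complex.I * (η j : ℂ)) • shiftedGrad G J η j)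

/-- The operator of the form `∑ ⟨D_j g, a_jk D_k f⟩ + c ⟨L g, L f⟩`, where `D` and `L` are the
shifted gradient and Laplacian. -/
noncomputable def shiftedForm [CompleteSpace E] (a : ι → ι → E →L[ℂ] E) (c : ℂ)
    (η : EuclideanSpace ℝ ι) : E →L[ℂ] E :=
  ∑ j, ∑ k, star (shiftedGrad G J η j) * (a j k * shiftedGrad G J η k) +
    c • (star (shiftedLap G H J η) * shiftedLap G H J η)

variable [CompleteSpace E]

lemma contDiff_shiftedForm (a : ι → ι → E →L[ℂ] E) (c : ℂ) :
    ContDiff ℝ ω (shiftedForm G H J a c) := by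
  have hη : ∀ j, ContDiff ℝ ω fun η : EuclideanSpace ℝ ι => Complex.I * (η j : ℂ) := fun j =>
    contDiff_const.mul (Complex.ofRealCLM.contDiff.comp (EuclideanSpace.proj (𝕜 := ℝ) j).contDiff)
  have hD : ∀ j, ContDiff ℝ ω fun η : EuclideanSpace ℝ ι => shiftedGrad G J η j := fun j =>
    contDiff_const.add ((hη j).smul contDiff_const)
  have hL : ContDiff ℝ ω (shiftedLap G H J) :=
    ContDiff.sum fun j _ => (contDiff_const.add ((hη j).smul contDiff_const)).add
      ((hη j).smul (hD j))
  -- The adjoint is conjugate-linear, so the analyticity is over `ℝ` only.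
  have hstar := (starL' ℝ : (E →L[ℂ] E) ≃L[ℝ] _).contDiff (n := ω)
  exact (ContDiff.sum fun j _ => ContDiff.sum fun k _ => (hstar.comp (hD j)).mul
    (contDiff_const.mul (hD k))).add (((hstar.comp hL).mul hL).const_smul c)

theorem analyticOnNhd_sInf_shiftedForm (a : ι → ι → E →L[ℂ] E) (c : ℂ) {e : E} {μ : ℝ}
    {U : Set (EuclideanSpace ℝ ι)} (hU : IsOpen U)
    (h : ∀ η ∈ U, HasGap (shiftedForm G H J a c η) J e μ) :
    AnalyticOnNhd ℝ (fun η => sInf (pencilEigenvalues (shiftedForm G H J a c η) J)) U :=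
  HasGap.analyticOnNhd_sInf (contDiff_shiftedForm G H J a c) hU h

end ShiftedForm

end Pencil

end BlochWave

namespace BlochWave

open scoped ContDiff Topology InnerProductSpace

/-! ### Fourier multipliers and the parametrization of `H²` by `L²`. -/

section FourierMultiplier

variable {d : ℕ}

lemma ext_coeff {u v : L2Per d} (h : ∀ n, coeff u n = coeff v n) : u = v :=
  (expBasis d).repr.injective (lp.ext (funext h))

lemma coeff_add (u v : L2Per d) (n : Fin d → ℤ) : coeff (u + v) n = coeff u n + coeff v n := by
  simp [coeff]

lemma coeff_smul (c : ℂ) (u : L2Per d) (n : Fin d → ℤ) : coeff (c • u) n = c * coeff u n := by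
  simp [coeff]

lemma coeff_sum {ι : Type*} (s : Finset ι) (u : ι → L2Per d) (n : Fin d → ℤ) :
    coeff (∑ i ∈ s, u i) n = ∑ i ∈ s, coeff (u i) n := by
  simp only [coeff, HilbertBasis.repr_apply_apply, inner_sum]

lemma hasSum_inner_coeff (u v : L2Per d) :
    HasSum (fun n => ⟪coeff u n, coeff v n⟫_ℂ) ⟪u, v⟫_ℂ := by
  rw [← (expBasis d).repr.inner_map_map]
  exact lp.hasSum_inner _ _

lemma hasSum_sq_coeff (u : L2Per d) : HasSum (fun n => ‖coeff u n‖ ^ 2) (‖u‖ ^ 2) := by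
  have := Complex.hasSum_re (hasSum_inner_coeff u u)
  simpa [inner_self_eq_norm_sq_to_K, ← Complex.ofReal_pow] using this

lemma memlp_mul_coeff {m : (Fin d → ℤ) → ℂ} {C : ℝ} (hm : ∀ n, ‖m n‖ ≤ C) (u : L2Per d) :
    Memℓp (fun n => m n * coeff u n) 2 := by
  refine memℓp_gen ?_
  have hs : Summable fun n => C ^ 2 * ‖coeff u n‖ ^ 2 := (hasSum_sq_coeff u).summable.mul_left _
  refine Summable.of_nonneg_of_le (fun n => by positivity) (fun n => ?_) hs
  rw [ENNReal.toReal_ofNat, Real.rpow_two, norm_mul, mul_pow]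
  gcongr
  exact hm n

/-- The Fourier multiplier with bounded symbol `m`. -/
noncomputable def fourierMul (m : (Fin d → ℤ) → ℂ) {C : ℝ} (hm : ∀ n, ‖m n‖ ≤ C) :
    L2Per d →L[ℂ] L2Per d :=
  LinearMap.mkContinuous
    { toFun := fun u => (expBasis d).repr.symm ⟨_, memlp_mul_coeff hm u⟩
      map_add' := fun u v => by
        rw [← map_add]
        congr 1
        ext n
        simp only [coeff_add, mul_add]
        rfl
      map_smul' := fun c u => by
        rw [RingHom.id_apply, ← map_smul]
        congr 1
        ext n
        simp [coeff_smul]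
        ring } C fun u => by
    have hC : 0 ≤ C := (norm_nonneg _).trans (hm 0)
    refine (sq_le_sq₀ (norm_nonneg _) (by positivity)).1 ?_
    rw [mul_pow]
    refine hasSum_le (fun n => ?_) (hasSum_sq_coeff _) ((hasSum_sq_coeff u).mul_left (C ^ 2))
    simp only [coeff, LinearMap.coe_mk, AddHom.coe_mk, LinearIsometryEquiv.apply_symm_apply,
      norm_mul, mul_pow]
    gcongr
    exact hm n

@[simp]
lemma coeff_fourierMul (m : (Fin d → ℤ) → ℂ) {C : ℝ} (hm : ∀ n, ‖m n‖ ≤ C) (u : L2Per d)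
    (n : Fin d → ℤ) : coeff (fourierMul m hm u) n = m n * coeff u n := by
  simp [fourierMul, coeff]

/-- An `L²` function with the right coefficients certifies that `pderiv` is not at its default
value. -/
lemma pderiv_eq {j : Fin d} {u v : L2Per d}
    (h : ∀ n, coeff v n = Complex.I * (n j : ℂ) * coeff u n) : pderiv j u = v := by
  have hv : (fun n : Fin d → ℤ => Complex.I * (n j : ℂ) * coeff u n) = (expBasis d).repr v :=
    funext fun n => (h n).symm
  have hm : Memℓp (fun n : Fin d → ℤ => Complex.I * (n j : ℂ) * coeff u n) 2 := by
    rw [hv]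
    exact lp.memℓp _
  rw [pderiv, dif_pos hm, LinearIsometryEquiv.symm_apply_eq]
  exact lp.ext hv

/-- The squared length `|n|²` of a frequency. -/
def freqSq (n : Fin d → ℤ) : ℝ := ∑ j, (n j : ℝ) ^ 2

lemma freqSq_nonneg (n : Fin d → ℤ) : 0 ≤ freqSq n := Finset.sum_nonneg fun _ _ => sq_nonneg _

lemma sq_le_freqSq (n : Fin d → ℤ) (j : Fin d) : (n j : ℝ) ^ 2 ≤ freqSq n :=
  Finset.single_le_sum (f := fun j => (n j : ℝ) ^ 2) (fun _ _ => sq_nonneg _) (Finset.mem_univ j)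

lemma one_le_freqSq {n : Fin d → ℤ} (hn : n ≠ 0) : 1 ≤ freqSq n := by
  obtain ⟨j, hj⟩ := Function.ne_iff.mp hn
  refine le_trans ?_ (sq_le_freqSq n j)
  have : (1 : ℤ) ≤ n j ^ 2 := by
    have := sq_pos_of_ne_zero (a := n j) hj
    omega
  exact_mod_cast this

/-- The symbol `(1 + |n|²)⁻¹` of the isomorphism from `L²` to `H²`. -/
noncomputable def weight (n : Fin d → ℤ) : ℝ := (1 + freqSq n)⁻¹

lemma weight_pos (n : Fin d → ℤ) : 0 < weight n := by
  have := freqSq_nonneg n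
  unfold weight
  positivity

lemma weight_mul (n : Fin d → ℤ) : weight n * (1 + freqSq n) = 1 :=
  inv_mul_cancel₀ (by have := freqSq_nonneg n; positivity)

lemma norm_mul_weight_le {z : ℂ} {n : Fin d → ℤ} (hz : ‖z‖ ≤ 1 + freqSq n) :
    ‖z * weight n‖ ≤ 1 := by
  rw [norm_mul, Complex.norm_real, Real.norm_of_nonneg (weight_pos n).le, ← weight_mul n, mul_comm]
  exact mul_le_mul_of_nonneg_left hz (weight_pos n).le

/-- The isomorphism `(1 - Δ)⁻¹` from `L²_♯` onto `H²_♯`. -/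
noncomputable def smoothing (d : ℕ) : L2Per d →L[ℂ] L2Per d :=
  fourierMul (fun n => 1 * weight n) (C := 1)
    fun n => norm_mul_weight_le (by simpa using freqSq_nonneg n)

/-- The operator `∂_j (1 - Δ)⁻¹`. -/
noncomputable def gradOp (j : Fin d) : L2Per d →L[ℂ] L2Per d :=
  fourierMul (fun n => Complex.I * n j * weight n) (C := 1) fun n => norm_mul_weight_le (by
    have := sq_le_freqSq n j
    rw [← sq_abs] at this
    simp only [norm_mul, Complex.norm_I, one_mul, Complex.norm_intCast]
    nlinarith [sq_nonneg (|(n j : ℝ)| - 1)])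

/-- The operator `∂_j² (1 - Δ)⁻¹`. -/
noncomputable def hessOp (j : Fin d) : L2Per d →L[ℂ] L2Per d :=
  fourierMul (fun n => -(n j : ℂ) ^ 2 * weight n) (C := 1) fun n => norm_mul_weight_le (by
    have := sq_le_freqSq n j
    rw [← sq_abs] at this
    simp only [norm_neg, norm_pow, Complex.norm_intCast]
    linarith)

/-- The operator `(∂_j + i η_j) (1 - Δ)⁻¹`. -/
noncomputable def shiftGradOp (η : EuclideanSpace ℝ (Fin d)) (j : Fin d) :
    L2Per d →L[ℂ] L2Per d :=
  shiftedGrad gradOp (smoothing d) η j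

/-- The operator `(∇ + i η)² (1 - Δ)⁻¹`. -/
noncomputable def shiftLapOp (η : EuclideanSpace ℝ (Fin d)) : L2Per d →L[ℂ] L2Per d :=
  shiftedLap gradOp hessOp (smoothing d) η

lemma coeff_smoothing (u : L2Per d) (n : Fin d → ℤ) :
    coeff (smoothing d u) n = weight n * coeff u n := by
  simp [smoothing]

lemma coeff_gradOp (j : Fin d) (u : L2Per d) (n : Fin d → ℤ) :
    coeff (gradOp j u) n = Complex.I * n j * weight n * coeff u n := by
  simp [gradOp]

lemma coeff_hessOp (j : Fin d) (u : L2Per d) (n : Fin d → ℤ) :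
    coeff (hessOp j u) n = -(n j : ℂ) ^ 2 * weight n * coeff u n := by
  simp [hessOp]

lemma shiftD_smoothing (η : EuclideanSpace ℝ (Fin d)) (j : Fin d) (f : L2Per d) :
    shiftD η j (smoothing d f) = shiftGradOp η j f := by
  rw [shiftD, pderiv_eq (v := gradOp j f)]
  · simp [shiftGradOp, shiftedGrad]
  · intro n
    rw [coeff_gradOp, coeff_smoothing]
    ring

/-- One smoothing factor absorbs both derivatives, so the second-order term is `hessOp j`, not the
square of `gradOp j`. -/
lemma shiftD_shiftGradOp (η : EuclideanSpace ℝ (Fin d)) (j : Fin d) (f : L2Per d) :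
    shiftD η j (shiftGradOp η j f) = ((hessOp j + (Complex.I * (η j : ℂ)) • gradOp j) +
    (Complex.I * (η j : ℂ)) • shiftGradOp η j) f := by
  rw [shiftD, pderiv_eq (v := (hessOp j + (Complex.I * (η j : ℂ)) • gradOp j) f)]
  · simp
  · intro n
    simp only [shiftGradOp, shiftedGrad, add_apply, smul_apply, coeff_add, coeff_smul, coeff_hessOp,
      coeff_gradOp, coeff_smoothing]
    linear_combination (-(n j : ℂ) ^ 2 * weight n * coeff f n) * Complex.I_sq

lemma shiftLap_smoothing (η : EuclideanSpace ℝ (Fin d)) (f : L2Per d) :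
    shiftLap η (smoothing d f) = shiftLapOp η f := by
  simp only [shiftLap, shiftD_smoothing, shiftD_shiftGradOp, shiftLapOp, shiftedLap, sum_apply]
  rfl

lemma memH2Per_iff {u : L2Per d} : MemH2Per u ↔ ∃ f, u = smoothing d f := by
  constructor
  · intro h
    have hm : Memℓp (fun n : Fin d → ℤ => ((1 + freqSq n : ℝ) : ℂ) * coeff u n) 2 := by
      refine memℓp_gen (h.congr fun n => ?_)
      rw [ENNReal.toReal_ofNat, Real.rpow_two, norm_mul, mul_pow, Complex.norm_real,
        Real.norm_eq_abs, sq_abs]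
      rfl
    refine ⟨(expBasis d).repr.symm ⟨_, hm⟩, ext_coeff fun n => ?_⟩
    rw [coeff_smoothing]
    simp only [coeff, LinearIsometryEquiv.apply_symm_apply]
    rw [← mul_assoc, ← Complex.ofReal_mul, weight_mul, Complex.ofReal_one, one_mul]
  · rintro ⟨f, rfl⟩
    refine (hasSum_sq_coeff f).summable.congr fun n => ?_
    change _ = (1 + freqSq n) ^ 2 * _
    rw [coeff_smoothing, norm_mul, mul_pow, Complex.norm_real, Real.norm_eq_abs, sq_abs,
      ← mul_assoc, ← mul_pow, mul_comm _ (weight n), weight_mul, one_pow, one_mul]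

/-- The squared length `|n + η|²` of a shifted frequency. -/
noncomputable def shiftSq (η : EuclideanSpace ℝ (Fin d)) (n : Fin d → ℤ) : ℝ :=
  ∑ j, ((n j : ℝ) + η j) ^ 2

lemma coeff_shiftGradOp (η : EuclideanSpace ℝ (Fin d)) (j : Fin d) (f : L2Per d)
    (n : Fin d → ℤ) : coeff (shiftGradOp η j f) n
      = Complex.I * (((n j : ℝ) + η j : ℝ) : ℂ) * weight n * coeff f n := by
  simp only [shiftGradOp, shiftedGrad, add_apply, smul_apply, coeff_add, coeff_smul, coeff_gradOp,
    coeff_smoothing]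
  push_cast
  ring

lemma coeff_shiftLapOp (η : EuclideanSpace ℝ (Fin d)) (f : L2Per d) (n : Fin d → ℤ) :
    coeff (shiftLapOp η f) n = -(shiftSq η n : ℂ) * weight n * coeff f n := by
  simp only [shiftLapOp, shiftedLap, sum_apply, coeff_sum, shiftSq, Complex.ofReal_sum,
    Finset.sum_mul, ← Finset.sum_neg_distrib]
  refine Finset.sum_congr rfl fun j _ => ?_
  change coeff (((hessOp j + (Complex.I * (η j : ℂ)) • gradOp j) +
    (Complex.I * (η j : ℂ)) • shiftGradOp η j) f) n = _
  simp only [add_apply, smul_apply, coeff_add, coeff_smul, coeff_hessOp,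
    coeff_gradOp, coeff_shiftGradOp]
  push_cast
  linear_combination
    (2 * n j * η j + (η j : ℂ) ^ 2) * weight n * coeff f n * Complex.I_sq

lemma norm_sq_coeff_shiftGradOp (η : EuclideanSpace ℝ (Fin d)) (j : Fin d) (f : L2Per d)
    (n : Fin d → ℤ) : ‖coeff (shiftGradOp η j f) n‖ ^ 2
      = ((n j : ℝ) + η j) ^ 2 * (weight n ^ 2 * ‖coeff f n‖ ^ 2) := by
  rw [coeff_shiftGradOp]
  simp only [norm_mul, Complex.norm_I, Complex.norm_real, Real.norm_eq_abs, mul_pow, sq_abs]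
  ring

lemma norm_sq_coeff_shiftLapOp (η : EuclideanSpace ℝ (Fin d)) (f : L2Per d)
    (n : Fin d → ℤ) : ‖coeff (shiftLapOp η f) n‖ ^ 2
      = shiftSq η n ^ 2 * (weight n ^ 2 * ‖coeff f n‖ ^ 2) := by
  rw [coeff_shiftLapOp]
  simp only [norm_mul, norm_neg, Complex.norm_real, Real.norm_eq_abs, mul_pow, sq_abs]
  ring

lemma freqSq_le_shiftSq {η : EuclideanSpace ℝ (Fin d)} (hη : ∑ j, η j ^ 2 ≤ 1 / 4)
    {n : Fin d → ℤ} (hn : n ≠ 0) : freqSq n / 4 ≤ shiftSq η n := by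
  have h1 := one_le_freqSq hn
  have h2 : freqSq n / 2 - ∑ j, η j ^ 2 ≤ shiftSq η n := by
    rw [freqSq, shiftSq, Finset.sum_div, ← Finset.sum_sub_distrib]
    refine Finset.sum_le_sum fun j _ => ?_
    -- `(n + η)² - n²/2 + η² = (n + 2η)²/2`.
    nlinarith [sq_nonneg ((n j : ℝ) + 2 * η j)]
  linarith

/-- The constant function `1` as an element of `L²_♯`. -/
noncomputable def constOne (d : ℕ) : L2Per d := expBasis d 0

lemma inner_constOne (f : L2Per d) : ⟪constOne d, f⟫_ℂ = coeff f 0 :=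
  ((expBasis d).repr_apply_apply f 0).symm

lemma norm_constOne : ‖constOne d‖ = 1 := (expBasis d).orthonormal.1 0

lemma coeff_constOne_of_ne {n : Fin d → ℤ} (hn : n ≠ 0) : coeff (constOne d) n = 0 := by
  rw [coeff, (expBasis d).repr_apply_apply]
  exact (expBasis d).orthonormal.2 hn

lemma weight_zero : weight (0 : Fin d → ℤ) = 1 := by simp [weight, freqSq]

lemma smoothing_constOne : smoothing d (constOne d) = constOne d := by
  refine ext_coeff fun n => ?_
  rw [coeff_smoothing]
  rcases eq_or_ne n 0 with rfl | hn
  · simp [weight_zero]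
  · simp [coeff_constOne_of_ne hn]

lemma shiftGradOp_constOne (η : EuclideanSpace ℝ (Fin d)) (j : Fin d) :
    shiftGradOp η j (constOne d) = (Complex.I * (η j : ℂ)) • constOne d := by
  refine ext_coeff fun n => ?_
  rw [coeff_shiftGradOp, coeff_smul]
  rcases eq_or_ne n 0 with rfl | hn
  · simp [weight_zero]
  · simp [coeff_constOne_of_ne hn]

lemma norm_shiftLapOp_constOne (η : EuclideanSpace ℝ (Fin d)) :
    ‖shiftLapOp η (constOne d)‖ = ∑ j, η j ^ 2 := by
  have : shiftLapOp η (constOne d) = (-((∑ j, η j ^ 2 : ℝ) : ℂ)) • constOne d := by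
    refine ext_coeff fun n => ?_
    rw [coeff_shiftLapOp, coeff_smul]
    rcases eq_or_ne n 0 with rfl | hn
    · simp [weight_zero, shiftSq]
    · simp [coeff_constOne_of_ne hn]
  rw [this, norm_smul, norm_constOne, norm_neg, Complex.norm_real, mul_one,
    Real.norm_of_nonneg (Finset.sum_nonneg fun _ _ => sq_nonneg _)]

lemma smoothing_symm (u v : L2Per d) : ⟪smoothing d u, v⟫_ℂ = ⟪u, smoothing d v⟫_ℂ := by
  refine (hasSum_inner_coeff _ _).unique ?_
  convert hasSum_inner_coeff u (smoothing d v) using 2 with n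
  simp [coeff_smoothing]
  ring

lemma smoothing_injective {u : L2Per d} (h : smoothing d u = 0) : u = 0 := by
  refine ext_coeff fun n => ?_
  have h1 : coeff (smoothing d u) n = coeff (0 : L2Per d) n := by rw [h]
  have h0 : coeff (0 : L2Per d) n = 0 := by simp [coeff]
  rw [coeff_smoothing, h0] at h1
  rw [h0]
  simpa [(weight_pos n).ne'] using h1

end FourierMultiplier

/-! ### The gap for the Bloch operator near `η = 0`. -/

section Operator

variable {d : ℕ} {a : Fin d → Fin d → L2Per d →L[ℂ] L2Per d} {α C ρ : ℝ}
  {η : EuclideanSpace ℝ (Fin d)}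

/-- The operator `(1 - Δ)⁻¹ (ρ² (∇+iη)⁴ - (∇+iη) · a (∇+iη)) (1 - Δ)⁻¹` on `L²_♯`. -/
noncomputable def blochOp (a : Fin d → Fin d → L2Per d →L[ℂ] L2Per d) (ρ : ℝ)
    (η : EuclideanSpace ℝ (Fin d)) : L2Per d →L[ℂ] L2Per d :=
  shiftedForm gradOp hessOp (smoothing d) a ((ρ : ℂ) ^ 2) η

lemma inner_blochOp (f g : L2Per d) : ⟪g, blochOp a ρ η f⟫_ℂ =
    ∑ j, ∑ k, ⟪shiftGradOp η j g, a j k (shiftGradOp η k f)⟫_ℂ +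
      (ρ : ℂ) ^ 2 * ⟪shiftLapOp η g, shiftLapOp η f⟫_ℂ := by
  change ⟪g, (∑ j, ∑ k, star (shiftGradOp η j) * (a j k * shiftGradOp η k) +
    ((ρ : ℂ) ^ 2) • (star (shiftLapOp η) * shiftLapOp η)) f⟫_ℂ = _
  simp only [ContinuousLinearMap.star_eq_adjoint, add_apply, sum_apply, smul_apply,
    mul_apply_eq_comp, inner_add_right, inner_sum, inner_smul_right,
    ContinuousLinearMap.adjoint_inner_right]

lemma blochOp_symm (hs : ∀ j k u v, ⟪a j k u, v⟫_ℂ = ⟪u, a k j v⟫_ℂ) (f g : L2Per d) :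
    ⟪blochOp a ρ η f, g⟫_ℂ = ⟪f, blochOp a ρ η g⟫_ℂ := by
  rw [← inner_conj_symm, inner_blochOp, inner_blochOp, map_add, map_sum, Finset.sum_comm]
  simp only [map_sum, map_mul, inner_conj_symm, hs, map_pow, Complex.conj_ofReal]

lemma re_inner_blochOp_ge (he : ∀ W : Fin d → L2Per d,
      α * ∑ j, ‖W j‖ ^ 2 ≤ (∑ j, ∑ k, ⟪W j, a j k (W k)⟫_ℂ).re) (f : L2Per d) :
    α * ∑ j, ‖shiftGradOp η j f‖ ^ 2 + ρ ^ 2 * ‖shiftLapOp η f‖ ^ 2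
      ≤ (⟪blochOp a ρ η f, f⟫_ℂ).re := by
  have h : (⟪blochOp a ρ η f, f⟫_ℂ).re = (⟪f, blochOp a ρ η f⟫_ℂ).re := by
    rw [← inner_conj_symm, Complex.conj_re]
  rw [h, inner_blochOp, inner_self_eq_norm_sq_to_K, Complex.add_re]
  refine add_le_add (he _) (le_of_eq ?_)
  simp [← Complex.ofReal_pow]

/-- Ellipticity replaces `T` by a Fourier multiplier, so the bound is checked frequency by
frequency. For `n ≠ 0`, `s = |n + η|² ≥ 1/4` gives `α s + ρ² s² ≥ μ`; at `n = 0` the rank-one term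
supplies `μ`. -/
lemma coercive_blochOp (hα : 0 < α) (hρ : 0 < ρ) (he : ∀ W : Fin d → L2Per d,
      α * ∑ j, ‖W j‖ ^ 2 ≤ (∑ j, ∑ k, ⟪W j, a j k (W k)⟫_ℂ).re)
    (hη : ∑ j, η j ^ 2 ≤ 1 / 4) {l : ℝ} (hl : l < α / 4 + ρ ^ 2 / 16) :
    ∃ c > 0, ∀ f, c * ‖f‖ ^ 2 ≤ (⟪blochOp a ρ η f, f⟫_ℂ).re - l * ‖smoothing d f‖ ^ 2 +
      (α / 4 + ρ ^ 2 / 16) * ‖⟪constOne d, f⟫_ℂ‖ ^ 2 := by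
  set μ := α / 4 + ρ ^ 2 / 16 with hμ
  have hμ0 : 0 < μ := by positivity
  -- Keeping a fixed fraction of the symbol `m` preserves the quartic growth that offsets the decay
  -- of `weight n ^ 2`.
  obtain ⟨θ, hθ, hθ'⟩ : ∃ θ > 0, ∀ m ≥ μ, θ * m ≤ m - l := by
    rcases le_total l 0 with h0 | h0
    · exact ⟨1, one_pos, fun m _ => by linarith⟩
    · refine ⟨1 - l / μ, by rw [gt_iff_lt, sub_pos, div_lt_one hμ0]; exact hl, fun m hm => ?_⟩
      have : l ≤ l / μ * m := by
        rw [div_mul_eq_mul_div, le_div_iff₀ hμ0]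
        gcongr
      linarith
  refine ⟨min (μ - l) (θ * (ρ ^ 2 / 64)), lt_min (sub_pos.2 hl) (by positivity), fun f => ?_⟩
  have hge := re_inner_blochOp_ge (ρ := ρ) (η := η) he f
  have h1 : HasSum (fun n => α * ∑ j, ‖coeff (shiftGradOp η j f) n‖ ^ 2)
      (α * ∑ j, ‖shiftGradOp η j f‖ ^ 2) :=
    (hasSum_sum fun j _ => hasSum_sq_coeff (shiftGradOp η j f)).mul_left α
  have h2 := (hasSum_sq_coeff (shiftLapOp η f)).mul_left (ρ ^ 2)
  have h3 := (hasSum_sq_coeff (smoothing d f)).mul_left l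
  have h4 : HasSum (fun n : Fin d → ℤ => if n = 0 then μ * ‖coeff f 0‖ ^ 2 else 0) (μ * ‖coeff f 0‖ ^ 2) :=
    hasSum_ite_eq 0 _
  have h5 := (hasSum_sq_coeff f).mul_left (min (μ - l) (θ * (ρ ^ 2 / 64)))
  have key := hasSum_le (fun n => ?_) h5 (((h1.add h2).sub h3).add h4)
  · rw [inner_constOne]
    linarith
  simp only [norm_sq_coeff_shiftGradOp, norm_sq_coeff_shiftLapOp, ← Finset.sum_mul]
  change _ ≤ α * (shiftSq η n * _) + _ - _ + _
  rw [coeff_smoothing, norm_mul, mul_pow, Complex.norm_real, Real.norm_eq_abs, sq_abs]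
  have hs0 : 0 ≤ shiftSq η n := Finset.sum_nonneg fun _ _ => sq_nonneg _
  rcases eq_or_ne n 0 with rfl | hn
  · rw [if_pos rfl, weight_zero]
    have := min_le_left (μ - l) (θ * (ρ ^ 2 / 64))
    have h6 : min (μ - l) (θ * (ρ ^ 2 / 64)) * ‖coeff f 0‖ ^ 2 ≤ (μ - l) * ‖coeff f 0‖ ^ 2 := by
      gcongr
    have h7 : 0 ≤ α * (shiftSq η 0 * ‖coeff f 0‖ ^ 2)
      + ρ ^ 2 * (shiftSq η 0 ^ 2 * ‖coeff f 0‖ ^ 2) := by positivity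
    linarith
  · rw [if_neg hn]
    set s := shiftSq η n with hs
    have hN := one_le_freqSq hn
    have hsN : freqSq n / 4 ≤ s := freqSq_le_shiftSq hη hn
    have hw := weight_pos n
    -- `s ≥ |n|²/4` and `|n|²/(1 + |n|²) ≥ 1/2`; squaring gives the constant `ρ²/64`.
    have hsw : 1 / 8 ≤ s * weight n := by
      rw [← weight_mul n]
      nlinarith
    have hm : μ ≤ α * s + ρ ^ 2 * s ^ 2 := by
      have : 1 / 16 ≤ s ^ 2 := by nlinarith
      nlinarith [sq_nonneg ρ]
    have h6 := hθ' _ hm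
    have h7 : ρ ^ 2 / 64 ≤ (α * s + ρ ^ 2 * s ^ 2) * weight n ^ 2 := by
      have h8 : 1 / 64 ≤ (s * weight n) ^ 2 := by nlinarith
      have h9 : 0 ≤ α * s * weight n ^ 2 := by positivity
      nlinarith [sq_nonneg ρ]
    have h10 : min (μ - l) (θ * (ρ ^ 2 / 64)) ≤ (α * s + ρ ^ 2 * s ^ 2 - l) * weight n ^ 2 :=
      calc _ ≤ θ * (ρ ^ 2 / 64) := min_le_right _ _
        _ ≤ θ * ((α * s + ρ ^ 2 * s ^ 2) * weight n ^ 2) := by gcongr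
        _ = θ * (α * s + ρ ^ 2 * s ^ 2) * weight n ^ 2 := by ring
        _ ≤ _ := by gcongr
    have h11 := mul_le_mul_of_nonneg_right h10 (sq_nonneg ‖coeff f n‖)
    linarith

/-- On constants the shifted gradient is `iη`, so the energy is at most `C d |η|² + ρ² |η|⁴`. The
last term fits in the `ρ²/16` of `μ`, so the smallness of `η` does not involve `ρ`. -/
lemma re_inner_blochOp_constOne_lt (hC : ∀ j k, ‖a j k‖ ≤ C) (hη : ∑ j, η j ^ 2 ≤ 1 / 4)
    (hηC : C * d * ∑ j, η j ^ 2 < α / 4) :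
    (⟪blochOp a ρ η (constOne d), constOne d⟫_ℂ).re < α / 4 + ρ ^ 2 / 16 := by
  have h0 : 0 ≤ ∑ j, η j ^ 2 := Finset.sum_nonneg fun _ _ => sq_nonneg _
  rw [← inner_conj_symm, Complex.conj_re, inner_blochOp, inner_self_eq_norm_sq_to_K,
    norm_shiftLapOp_constOne, Complex.add_re]
  refine add_lt_add_of_lt_of_le (lt_of_le_of_lt ?_ hηC) ?_
  · have hCd : ∀ j k, (⟪shiftGradOp η j (constOne d),
        a j k (shiftGradOp η k (constOne d))⟫_ℂ).re ≤ C * (|η j| * |η k|) := by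
      intro j k
      refine (Complex.re_le_norm _).trans ((norm_inner_le_norm _ _).trans ?_)
      have h1 : ∀ j, ‖shiftGradOp η j (constOne d)‖ = |η j| := fun j => by
        simp [shiftGradOp_constOne, norm_smul, norm_constOne]
      have h2 := (a j k).le_of_opNorm_le (hC j k) (shiftGradOp η k (constOne d))
      rw [h1] at h2 ⊢
      calc _ ≤ |η j| * (C * |η k|) := by gcongr
        _ = _ := by ring
    rw [Complex.re_sum]
    simp only [Complex.re_sum]
    refine (Finset.sum_le_sum fun j _ => Finset.sum_le_sum fun k _ => hCd j k).trans ?_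
    have h3 : ∑ j, ∑ k, C * (|η j| * |η k|) = C * (∑ j, |η j|) ^ 2 := by
      rw [sq, Finset.sum_mul_sum, Finset.mul_sum]
      simp only [Finset.mul_sum]
    have h4 : (∑ j, |η j|) ^ 2 ≤ d * ∑ j, η j ^ 2 := by
      simpa using sq_sum_le_card_mul_sum_sq (s := Finset.univ) (f := fun j => |η j|)
    rw [h3, mul_assoc]
    rcases Nat.eq_zero_or_pos d with rfl | hd
    · simp
    · have : 0 ≤ C := (norm_nonneg _).trans (hC ⟨0, hd⟩ ⟨0, hd⟩)
      gcongr
  · have : (∑ j, η j ^ 2) ^ 2 ≤ 1 / 16 := by nlinarith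
    simp only [Complex.coe_algebraMap, ← Complex.ofReal_pow, ← Complex.ofReal_mul,
      Complex.ofReal_re]
    nlinarith [sq_nonneg ρ]

lemma hasGap_blochOp (hs : ∀ j k u v, ⟪a j k u, v⟫_ℂ = ⟪u, a k j v⟫_ℂ)
    (hC : ∀ j k, ‖a j k‖ ≤ C) (hα : 0 < α) (hρ : 0 < ρ) (he : ∀ W : Fin d → L2Per d,
      α * ∑ j, ‖W j‖ ^ 2 ≤ (∑ j, ∑ k, ⟪W j, a j k (W k)⟫_ℂ).re)
    (hη : ∑ j, η j ^ 2 ≤ 1 / 4) (hηC : C * d * ∑ j, η j ^ 2 < α / 4) :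
    HasGap (blochOp a ρ η) (smoothing d) (constOne d) (α / 4 + ρ ^ 2 / 16) where
  symm_left := blochOp_symm hs
  symm_right := smoothing_symm
  injective _ := smoothing_injective
  map_base := smoothing_constOne
  norm_base := norm_constOne
  nonneg f := le_trans (by positivity) (re_inner_blochOp_ge he f)
  coercive _ hl := coercive_blochOp hα hρ he hη hl
  lt := re_inner_blochOp_constOne_lt hC hη hηC

end Operator

end BlochWave

namespace BlochWave

open MeasureTheory
open scoped ContDiff Topology InnerProductSpace ENNReal

/-! ### Transfer between the cell and the torus; multiplication operators. -/

section Cell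

variable {d : ℕ}

lemma measurePreserving_equivIco_coe :
    MeasurePreserving (fun x : UnitAddCircle => (AddCircle.equivIco (1 : ℝ) 0 x : ℝ))
      AddCircle.haarAddCircle (volume.restrict (Set.Ico 0 1)) := by
  have hm : Measurable fun x : UnitAddCircle => (AddCircle.equivIco (1 : ℝ) 0 x : ℝ) :=
    measurable_subtype_coe.comp (AddCircle.measurableEquivIco 1 0).measurable
  refine ⟨hm, ?_⟩
  have h1 : (AddCircle.haarAddCircle : Measure UnitAddCircle) = volume := by
    rw [AddCircle.volume_eq_smul_haarAddCircle]; simp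
  have h2 := (AddCircle.measurePreserving_mk (1 : ℝ) 0).map_eq
  rw [zero_add, ← Measure.restrict_congr_set Ico_ae_eq_Ioc] at h2
  rw [h1, ← h2, Measure.map_map hm AddCircle.measurable_mk']
  conv_rhs => rw [← Measure.map_id (μ := volume.restrict (Set.Ico (0 : ℝ) 1))]
  refine Measure.map_congr ?_
  filter_upwards [ae_restrict_mem measurableSet_Ico] with t ht
  have ht' : t ∈ Set.Ico (0 : ℝ) (0 + 1) := by simpa using ht
  simp [AddCircle.equivIco_coe_eq ht']

/-- This carries almost-everywhere hypotheses on `A` to the torus; only null sets matter, not the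
Jacobian of the dilation. -/
lemma quasiMeasurePreserving_cellPoint :
    Measure.QuasiMeasurePreserving (cellPoint (d := d)) (torusMeasure d) volume := by
  have h1 := measurePreserving_pi (fun _ : Fin d => AddCircle.haarAddCircle)
    (fun _ : Fin d => (volume : Measure ℝ).restrict (Set.Ico 0 1))
    fun _ => measurePreserving_equivIco_coe
  have h2 : Measure.QuasiMeasurePreserving (fun y : Fin d → ℝ => (2 * Real.pi) • y)
      (Measure.pi fun _ : Fin d => (volume : Measure ℝ).restrict (Set.Ico 0 1)) volume := by
    refine ⟨measurable_const_smul _, Measure.AbsolutelyContinuous.mk fun s hs h0 => ?_⟩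
    rw [Measure.map_apply (measurable_const_smul _) hs,
      ← Measure.restrict_pi_pi (fun _ : Fin d => (volume : Measure ℝ)) fun _ => Set.Ico 0 1]
    refine Measure.absolutelyContinuous_of_le Measure.restrict_le_self ?_
    change volume _ = 0
    rw [Measure.addHaar_preimage_smul _ (by positivity), h0, mul_zero]
  exact h2.comp h1.quasiMeasurePreserving

/-- Multiplication by a bounded real function on `L²_♯`. -/
lemma exists_mulOp {g : UnitAddTorus (Fin d) → ℝ} (hg : AEStronglyMeasurable g (torusMeasure d))
    {M : ℝ} (hM : ∀ᵐ x ∂torusMeasure d, |g x| ≤ M) :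
    ∃ a : L2Per d →L[ℂ] L2Per d, ∀ u, a u =ᵐ[torusMeasure d] fun x => (g x : ℂ) * u x := by
  have h : MemLp (fun x => (g x : ℂ)) ∞ (torusMeasure d) :=
    memLp_top_of_bound (Complex.continuous_ofReal.comp_aestronglyMeasurable hg) M
      (by simpa using hM)
  refine ⟨(ContinuousLinearMap.mul ℂ ℂ).holderL (torusMeasure d) ∞ 2 2 h.toLp, fun u => ?_⟩
  filter_upwards [(ContinuousLinearMap.mul ℂ ℂ).coeFn_holder (r := 2) h.toLp u, h.coeFn_toLp]
    with x hx hx'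
  refine hx.trans ?_
  rw [hx', ContinuousLinearMap.mul_apply']

variable {g : UnitAddTorus (Fin d) → ℝ} {a : L2Per d →L[ℂ] L2Per d}

lemma integrable_inner_mulOp (ha : ∀ u, a u =ᵐ[torusMeasure d] fun x => (g x : ℂ) * u x)
    (u v : L2Per d) :
    Integrable (fun x => (g x : ℂ) * u x * (starRingEnd ℂ) (v x)) (torusMeasure d) := by
  refine (L2.integrable_inner (𝕜 := ℂ) v (a u)).congr ?_
  filter_upwards [ha u] with x hx
  rw [RCLike.inner_apply, hx]

lemma inner_mulOp (ha : ∀ u, a u =ᵐ[torusMeasure d] fun x => (g x : ℂ) * u x)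
    (u v : L2Per d) :
    ⟪v, a u⟫_ℂ = ∫ x, (g x : ℂ) * u x * (starRingEnd ℂ) (v x) ∂torusMeasure d := by
  rw [L2.inner_def]
  refine integral_congr_ae ?_
  filter_upwards [ha u] with x hx
  rw [RCLike.inner_apply, hx]

lemma innerY_eq (u v : L2Per d) : innerY u v = ((2 * Real.pi) ^ d : ℝ) * ⟪v, u⟫_ℂ := by
  rw [innerY, cellIntegral, L2.inner_def]
  rfl

end Cell

/-! ### The Bloch form as the form of `blochOp`. -/

section Coefficients

variable {d : ℕ} {A : (Fin d → ℝ) → Matrix (Fin d) (Fin d) ℝ}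
  {a : Fin d → Fin d → L2Per d →L[ℂ] L2Per d}

lemma blochForm_smoothing
    (ha : ∀ j k u, a j k u =ᵐ[torusMeasure d] fun x => (A (cellPoint x) j k : ℂ) * u x)
    (ρ : ℝ) (η : EuclideanSpace ℝ (Fin d)) (f g : L2Per d) :
    blochForm A ρ η (smoothing d f) (smoothing d g)
      = ((2 * Real.pi) ^ d : ℝ) * ⟪g, blochOp a ρ η f⟫_ℂ := by
  have h1 := innerY_eq (shiftLapOp η f) (shiftLapOp η g)
  rw [innerY] at h1
  simp only [blochForm, shiftD_smoothing, shiftLap_smoothing, h1, inner_blochOp]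
  rw [cellIntegral, integral_finsetSum _ fun j _ => integrable_finsetSum _ fun k _ =>
    integrable_inner_mulOp (ha j k) _ _, Finset.sum_congr rfl fun j _ => integral_finsetSum _
    fun k _ => integrable_inner_mulOp (ha j k) (shiftGradOp η k f) (shiftGradOp η j g)]
  simp only [fun j k => inner_mulOp (ha j k)]
  ring

lemma blochEigenvalues_eq
    (ha : ∀ j k u, a j k u =ᵐ[torusMeasure d] fun x => (A (cellPoint x) j k : ℂ) * u x)
    (ρ : ℝ) (η : EuclideanSpace ℝ (Fin d)) :
    blochEigenvalues A ρ η = pencilEigenvalues (blochOp a ρ η) (smoothing d) := by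
  have hπ : (((2 * Real.pi) ^ d : ℝ) : ℂ) ≠ 0 := by
    exact_mod_cast (by positivity : (2 * Real.pi) ^ d ≠ 0)
  ext l
  constructor
  · rintro ⟨φ, hφ, hφ0, h⟩
    obtain ⟨f, rfl⟩ := memH2Per_iff.1 hφ
    refine ⟨f, fun h0 => hφ0 (by rw [h0, map_zero]), ext_inner_left ℂ fun g => ?_⟩
    have h1 := h (smoothing d g) (memH2Per_iff.2 ⟨g, rfl⟩)
    rw [blochForm_smoothing ha, innerY_eq, mul_left_comm] at h1
    rw [mul_left_cancel₀ hπ h1, inner_smul_right, smoothing_symm]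
  · rintro ⟨f, hf, h⟩
    refine ⟨smoothing d f, memH2Per_iff.2 ⟨f, rfl⟩, fun h0 => hf (smoothing_injective h0),
      fun v hv => ?_⟩
    obtain ⟨g, rfl⟩ := memH2Per_iff.1 hv
    rw [blochForm_smoothing ha, innerY_eq, h, inner_smul_right, smoothing_symm]
    ring

lemma inner_mulOp_symm
    (ha : ∀ j k u, a j k u =ᵐ[torusMeasure d] fun x => (A (cellPoint x) j k : ℂ) * u x)
    (hA : ∀ᵐ x ∂torusMeasure d, (A (cellPoint x)).IsSymm) (j k : Fin d) (u v : L2Per d) :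
    ⟪a j k u, v⟫_ℂ = ⟪u, a k j v⟫_ℂ := by
  rw [L2.inner_def, L2.inner_def]
  refine integral_congr_ae ?_
  filter_upwards [ha j k u, ha k j v, hA] with x h1 h2 h3
  rw [RCLike.inner_apply, RCLike.inner_apply, h1, h2, h3.apply, map_mul, Complex.conj_ofReal]
  ring

/-- Add the real inequality for the real and imaginary parts of `z`; the mixed products are purely
imaginary. -/
lemma le_re_sum_mul_conj {B : Matrix (Fin d) (Fin d) ℝ} {α : ℝ}
    (hB : ∀ ξ : Fin d → ℝ, α * (ξ ⬝ᵥ ξ) ≤ B.mulVec ξ ⬝ᵥ ξ) (z : Fin d → ℂ) :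
    α * ∑ j, ‖z j‖ ^ 2 ≤ (∑ j, ∑ k, (B j k : ℂ) * z k * (starRingEnd ℂ) (z j)).re := by
  have h := add_le_add (hB fun j => (z j).re) (hB fun j => (z j).im)
  simp only [dotProduct, Matrix.mulVec, ← mul_add, Finset.sum_mul, ← Finset.sum_add_distrib] at h
  simp only [Complex.sq_norm, Complex.normSq_apply, Complex.re_sum]
  refine h.trans (le_of_eq (Finset.sum_congr rfl fun j _ => Finset.sum_congr rfl fun k _ => ?_))
  simp

lemma le_re_sum_inner_mulOp
    (ha : ∀ j k u, a j k u =ᵐ[torusMeasure d] fun x => (A (cellPoint x) j k : ℂ) * u x)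
    {α : ℝ} (hA : ∀ᵐ x ∂torusMeasure d, ∀ ξ : Fin d → ℝ,
      α * (ξ ⬝ᵥ ξ) ≤ (A (cellPoint x)).mulVec ξ ⬝ᵥ ξ) (W : Fin d → L2Per d) :
    α * ∑ j, ‖W j‖ ^ 2 ≤ (∑ j, ∑ k, ⟪W j, a j k (W k)⟫_ℂ).re := by
  have hi := fun j k => integrable_inner_mulOp (ha j k) (W k) (W j)
  have hn : ∀ j, Integrable (fun x => ‖W j x‖ ^ 2) (torusMeasure d) := fun j =>
    (memLp_two_iff_integrable_sq_norm (Lp.aestronglyMeasurable _)).1 (Lp.memLp (W j))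
  have h1 : ∀ j, ‖W j‖ ^ 2 = ∫ x, ‖W j x‖ ^ 2 ∂torusMeasure d := fun j => by
    have h2 := congrArg Complex.re (L2.inner_def (𝕜 := ℂ) (W j) (W j))
    rw [inner_self_eq_norm_sq_to_K] at h2
    have h3 : ∀ x, ⟪W j x, W j x⟫_ℂ = ((‖W j x‖ ^ 2 : ℝ) : ℂ) := fun x => by
      rw [inner_self_eq_norm_sq_to_K]; simp
    simp only [h3, integral_complex_ofReal, Complex.ofReal_re] at h2
    simpa [← Complex.ofReal_pow] using h2
  have hs : Integrable (fun x => ∑ j, ∑ k,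
      (A (cellPoint x) j k : ℂ) * W k x * (starRingEnd ℂ) (W j x)) (torusMeasure d) :=
    integrable_finsetSum _ fun j _ => integrable_finsetSum _ fun k _ => hi j k
  simp only [h1, fun j k => inner_mulOp (ha j k)]
  rw [← integral_finsetSum _ fun j _ => hn j, ← integral_const_mul]
  simp only [← integral_finsetSum _ fun k _ => hi _ k]
  rw [← integral_finsetSum _ fun j _ => integrable_finsetSum _ fun k _ => hi j k]
  refine le_of_le_of_eq (integral_mono_ae ((integrable_finsetSum _ fun j _ => hn j).const_mul α)
    hs.re ?_) (integral_re hs)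
  filter_upwards [hA] with x hx
  exact le_re_sum_mul_conj hx _

end Coefficients

end BlochWave

open BlochWave MeasureTheory

theorem theorem4p4 (d : ℕ) (A : (Fin d → ℝ) → Matrix (Fin d) (Fin d) ℝ)
    (hmeas : ∀ j k, Measurable fun y => A y j k)
    (hbdd : ∃ M : ℝ, ∀ᵐ y, ∀ j k, |A y j k| ≤ M)
    (hell : ∃ α : ℝ, 0 < α ∧ ∀ᵐ y, ∀ ξ : Fin d → ℝ, α * (ξ ⬝ᵥ ξ) ≤ (A y).mulVec ξ ⬝ᵥ ξ)
    (hper : ∀ p : Fin d → ℤ, ∀ᵐ y : Fin d → ℝ, A (fun j => y j + 2 * Real.pi * p j) = A y)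
    (hsymm : ∀ᵐ y, (A y).IsSymm) :
    ∃ δ : ℝ, 0 < δ ∧ ∀ ρ : ℝ, 0 < ρ →
      (∀ η ∈ Metric.ball (0 : EuclideanSpace ℝ (Fin d)) δ,
        IsLeast (BlochWave.blochEigenvalues A ρ η) (BlochWave.firstBlochEigenvalue A ρ η)) ∧
      AnalyticOnNhd ℝ (BlochWave.firstBlochEigenvalue A ρ)
        (Metric.ball (0 : EuclideanSpace ℝ (Fin d)) δ) := by
  obtain ⟨M, hM⟩ := hbdd
  obtain ⟨α, hα, hell⟩ := hell
  have hq := quasiMeasurePreserving_cellPoint (d := d)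
  have hex : ∀ j k, ∃ a : L2Per d →L[ℂ] L2Per d, ∀ u,
      a u =ᵐ[torusMeasure d] fun x => (A (cellPoint x) j k : ℂ) * u x := fun j k =>
    exists_mulOp (g := fun x => A (cellPoint x) j k)
      ((hmeas j k).comp hq.measurable).aestronglyMeasurable
      (M := M) ((hq.ae hM).mono fun x hx => hx j k)
  choose a ha using hex
  set C := ∑ j, ∑ k, ‖a j k‖ with hC
  have hC0 : 0 ≤ C := by positivity
  have haC : ∀ j k, ‖a j k‖ ≤ C := fun j k =>
    (Finset.single_le_sum (f := fun k => ‖a j k‖) (fun _ _ => norm_nonneg _)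
      (Finset.mem_univ k)).trans (Finset.single_le_sum (f := fun j => ∑ k, ‖a j k‖)
      (fun _ _ => by positivity) (Finset.mem_univ j))
  -- The first bound gives `|η|² ≤ 1/4`; with `|η| ≤ 1`, the second gives `C d |η|² < α/4`. The `+
  -- 1` keeps the denominator positive.
  set δ := min (1 / 2) (α / (4 * (C * d + 1))) with hδ
  refine ⟨δ, by positivity, fun ρ hρ => ?_⟩
  have hgap : ∀ η ∈ Metric.ball (0 : EuclideanSpace ℝ (Fin d)) δ,
      HasGap (blochOp a ρ η) (smoothing d) (constOne d) (α / 4 + ρ ^ 2 / 16) := by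
    intro η hη
    rw [mem_ball_zero_iff] at hη
    have h1 : ∑ j, η j ^ 2 = ‖η‖ ^ 2 := by
      rw [EuclideanSpace.norm_sq_eq]; simp
    have h2 : ‖η‖ < 1 / 2 := hη.trans_le (min_le_left _ _)
    have h3 : ‖η‖ * (4 * (C * d + 1)) < α :=
      (lt_div_iff₀ (by positivity)).1 (hη.trans_le (min_le_right _ _))
    have h4 := norm_nonneg η
    have h5 : 0 ≤ C * d := by positivity
    refine hasGap_blochOp (inner_mulOp_symm ha (hq.ae hsymm)) haC hα hρ
      (le_re_sum_inner_mulOp ha (hq.ae hell)) ?_ ?_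
    · rw [h1]; nlinarith
    · rw [h1]
      have h6 : C * d * ‖η‖ * ‖η‖ ≤ C * d * ‖η‖ * 1 := by gcongr; linarith
      nlinarith
  have hfirst : firstBlochEigenvalue A ρ =
      fun η => sInf (pencilEigenvalues (blochOp a ρ η) (smoothing d)) :=
    funext fun η => by rw [firstBlochEigenvalue, blochEigenvalues_eq ha]
  refine ⟨fun η hη => ?_, ?_⟩
  · rw [firstBlochEigenvalue, blochEigenvalues_eq ha]
    exact (hgap η hη).isLeast_sInf
  · rw [hfirst]
    exact analyticOnNhd_sInf_shiftedForm _ _ _ a _ Metric.isOpen_ball hgap
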